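/- The graph ${\cal I}_{4,5}$ of the hyperbolic Pascal triangle linked to the regular mosaic $\{4,5\}$ is drawn row by row. Row $0$ is a single vertex with two edges to row $1$. Given row $n$, its vertices send edges down to row $n+1$, drawn from left to right: the leftmost and the rightmost vertex of a row $n\ge1$ (the wingers) send $2$ edges, an inner vertex joined to two vertices of the previous row sends $3$ edges, and an inner vertex joined to one vertex of the previous row sends $4$ edges. The last edge of each vertex and the first edge of its right neighbour end in the same vertex of row $n+1$, all other edges end in distinct vertices, and these endpoints, from left to right, form row $n+1$. A vertex joined to two vertices of the previous row has type $A$; every other vertex, including the wingers, has type $B$. Let $s_n$ be the number of vertices of row $n$, and let $\varphi_n$ be the integer whose binary expansion is obtained by reading the types of the vertices of row $n$ from left to right and writing $0$ for $A$ and $1$ for $B$ (for example, row $3$ is $BABAB$ and $\varphi_3=10101_2=21$). Put $S_n=2^{s_{n+1}-s_n}$ and $\Phi_n=\varphi_{n+1}-\varphi_n$. Then $$ \Phi_n=\left(\frac{S_n}{S_{n-1}}+S_n+S_{n-1}\right)\Phi_{n-1}-S_{n-1}^2\,\Phi_{n-2}\qquad(n\ge3). $$ -/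

import Mathlib

/-!
The graph of the hyperbolic Pascal triangle linked to the mosaic with Schlaefli symbol {4, q}, drawn
row by row by its growing rule.  The apex (row 0) and the two wingers (leftmost and rightmost vertex)
of each row `n ≥ 1` send 2 edges to the row below, an inner vertex with two ascendants sends `q - 2`
edges and an inner vertex with one ascendant sends `q - 1` edges.  The edges are drawn from left to
right; the last edge of a vertex and the first edge of its right neighbour end in the same vertex, and
all other edges end in distinct vertices.
-/
namespace HypPascal

/-- A row is drawn from the list `d` of the numbers of downward edges of its vertices, from left to
right.  This is the position in the row below of the endpoint of the first edge of vertex `i`: each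
vertex on its left takes up one position fewer than it has edges, because its last edge meets the
first edge of its right neighbour. -/
def firstChild (d : List ℕ) (i : ℕ) : ℕ :=
  ((d.take i).map (fun k => k - 1)).sum

/-- Vertex `i` of the row `d` is joined to vertex `j` of the row below. -/
def Joined (d : List ℕ) (i j : ℕ) : Prop :=
  i < d.length ∧ firstChild d i ≤ j ∧ j < firstChild d i + d.getD i 0

instance (d : List ℕ) (i j : ℕ) : Decidable (Joined d i j) := by
  unfold Joined; infer_instance

/-- The number of vertices in the row below the row `d`. -/
def nextLength (d : List ℕ) : ℕ := (d.map (fun k => k - 1)).sum + 1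

/-- The number of edges going up from vertex `j` of the row below the row `d`. -/
def upDegree (d : List ℕ) (j : ℕ) : ℕ :=
  ((Finset.range d.length).filter (fun i => Joined d i j)).card

/-- The numbers of downward edges of the vertices of the row below the row `d`. -/
def nextRow (q : ℕ) (d : List ℕ) : List ℕ :=
  (List.range (nextLength d)).map fun j =>
    if j = 0 ∨ j + 1 = nextLength d then 2
    else if upDegree d j = 2 then q - 2
    else q - 1

/-- The numbers of downward edges of the vertices of row `n`, from left to right. -/
def downDegrees (q : ℕ) : ℕ → List ℕ
  | 0 => [2]
  | n + 1 => nextRow q (downDegrees q n)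

/-- The number `s_n` of vertices of row `n`. -/
def rowLength (q n : ℕ) : ℕ := (downDegrees q n).length

/-- The vertices: `⟨n, i⟩` is the vertex number `i` (counted from the left, from `0`) of row `n`. -/
abbrev Vertex (q : ℕ) : Type := Σ n : ℕ, Fin (rowLength q n)

/-- The graph of the hyperbolic Pascal triangle linked to {4, q}. -/
def graph (q : ℕ) : SimpleGraph (Vertex q) :=
  SimpleGraph.fromRel fun u v => v.1 = u.1 + 1 ∧ Joined (downDegrees q u.1) u.2 v.2

/-- The ascendants of a vertex: its neighbours in the previous row. -/
def ascendants (q : ℕ) (v : Vertex q) : Set (Vertex q) :=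
  {u | (graph q).Adj u v ∧ u.1 + 1 = v.1}

/-- The two types of vertices. -/
inductive VertexType
  | A
  | B

/-- A vertex with two ascendants has type `A`, the others have type `B`.  In particular the wingers,
having one ascendant, are considered as type `B`. -/
noncomputable def vertexType (q : ℕ) (v : Vertex q) : VertexType :=
  if (ascendants q v).ncard = 2 then VertexType.A else VertexType.B

/-- The binary digit encoding a type. -/
def VertexType.digit : VertexType → ℕ
  | VertexType.A => 0
  | VertexType.B => 1

/-- The integer `φ_n` whose binary expansion is the code of row `n` of the triangle linked to {4, 5},
read from left to right (the leftmost digit is the most significant one). -/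
noncomputable def phi (n : ℕ) : ℕ :=
  ∑ i : Fin (rowLength 5 n), (vertexType 5 ⟨n, i⟩).digit * 2 ^ (rowLength 5 n - 1 - (i : ℕ))

/-- `Φ_n = φ_{n+1} - φ_n`. -/
noncomputable def Phi (n : ℕ) : ℤ := (phi (n + 1) : ℤ) - (phi n : ℤ)

/-- `S_n = 2 ^ (s_{n+1} - s_n)`. -/
def S (n : ℕ) : ℚ := (2 : ℚ) ^ ((rowLength 5 (n + 1) : ℤ) - (rowLength 5 n : ℤ))

end HypPascal

namespace HypPascal

/-! ### Up degrees of the vertices of a row -/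

/-! Below an inner vertex lie the shared endpoint of its first edge, of type A, and its unshared
endpoints, of type B. So inner codes evolve by A ↦ AB, B ↦ ABB, with a final A contributed by the
right winger (`nextRow_wingers`). Write A_n, B_n for the iterates of the two letters. Then A_{n+1} =
A_n B_n and B_{n+1} = A_{n+1} B_n, and each inner code is an A_n followed by the previous inner code
(`innerCode_succ`). Hence consecutive rows share a suffix, and their difference is a power of 2
times L(A_n), where L(w) is the value of 1w minus one (`Phi_succ`). Since L(lm) = 2^|m| L(l) + L(m),
eliminating L(B_n) gives a second-order recurrence for L(A_n); the lengths of the words turn its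
coefficients into the S_n. -/

lemma firstChild_cons_zero (k : ℕ) (d : List ℕ) : firstChild (k :: d) 0 = 0 := by
  simp [firstChild]

lemma firstChild_cons_succ (k : ℕ) (d : List ℕ) (i : ℕ) :
    firstChild (k :: d) (i + 1) = (k - 1) + firstChild d i := by
  simp [firstChild]

lemma upDegree_eq_sum (d : List ℕ) (j : ℕ) :
    upDegree d j = ∑ i ∈ Finset.range d.length, if Joined d i j then 1 else 0 := by
  simp [upDegree]

lemma upDegree_nil (j : ℕ) : upDegree [] j = 0 := by
  simp [upDegree]

lemma joined_cons_zero (k : ℕ) (d : List ℕ) (j : ℕ) : Joined (k :: d) 0 j ↔ j < k := by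
  simp [Joined, firstChild_cons_zero]

lemma joined_cons_succ (k : ℕ) (d : List ℕ) (i j : ℕ) :
    Joined (k :: d) (i + 1) j ↔ k - 1 ≤ j ∧ Joined d i (j - (k - 1)) := by
  simp only [Joined, firstChild_cons_succ, List.length_cons, List.getD_cons_succ]
  omega

lemma upDegree_cons (k : ℕ) (d : List ℕ) (j : ℕ) :
    upDegree (k :: d) j =
      (if j < k then 1 else 0) + if k - 1 ≤ j then upDegree d (j - (k - 1)) else 0 := by
  rw [upDegree_eq_sum, List.length_cons, Finset.sum_range_succ']
  simp only [joined_cons_zero, joined_cons_succ]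
  rw [add_comm]
  congr 1
  split_ifs with h
  · simp [h, upDegree_eq_sum]
  · simp [h]

/-- The code of the vertices of the next row that lie below an inner vertex with the code `b`, the
endpoint of its last edge excepted. -/
def substitution (b : ℕ) : List ℕ := 0 :: List.replicate (b + 1) 1

/-- The up degree of a vertex with the code `b`. -/
def upDegreeOfCode (b : ℕ) : ℕ := if b = 0 then 2 else 1

/-- The left winger is cut off, so that induction can peel vertices from the left. The extra 1 at `j
= 0` is the last edge of the vertex just removed; the final `[0, 1]` comes from the right winger. -/
lemma map_upDegree_inner (w : List ℕ) :
    (List.range (((w.map (· + 3)).map (fun k => k - 1)).sum + 2)).map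
        (fun j => (if j = 0 then 1 else 0) + upDegree (w.map (· + 3) ++ [2]) j) =
      (w.flatMap substitution ++ [0, 1]).map upDegreeOfCode := by
  induction w with
  | nil =>
    simp [List.range_succ, upDegree_cons, upDegree_nil, upDegreeOfCode]
  | cons b w ih =>
    have hlen : (((b :: w).map (· + 3)).map (fun k => k - 1)).sum + 2 =
        (b + 2) + (((w.map (· + 3)).map (fun k => k - 1)).sum + 2) := by
      simp only [List.map_cons, List.sum_cons]
      omega
    rw [hlen, List.range_add, List.map_append, List.flatMap_cons, List.append_assoc,
      List.map_append]
    congr 1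
    · apply List.ext_getElem
      · simp [substitution]
      · intro i h1 h2
        simp only [List.length_map, List.length_range] at h1
        simp only [List.getElem_map, List.getElem_range, List.map_cons, List.cons_append,
          upDegree_cons]
        rw [if_pos (show i < b + 3 by omega), if_neg (show ¬ b + 3 - 1 ≤ i by omega)]
        rcases i with _ | i <;> simp [substitution, upDegreeOfCode]
    · rw [← ih, List.map_map]
      apply List.map_congr_left
      intro j _
      simp only [Function.comp, List.map_cons, List.cons_append, upDegree_cons]
      rw [if_neg (show ¬ b + 2 + j = 0 by omega), if_pos (show b + 3 - 1 ≤ b + 2 + j by omega),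
        show b + 2 + j - (b + 3 - 1) = j by omega, zero_add]
      -- The last edge of the peeled vertex supplies the extra 1 for the tail.
      congr 1
      exact if_congr (by omega) rfl rfl

/-! ### The codes of the rows -/

/-- The code of the row `n + 1` without its two wingers. -/
def innerCode : ℕ → List ℕ
  | 0 => []
  | n + 1 => (innerCode n).flatMap substitution ++ [0]

/-- The code of the row `n + 1`. -/
def rowCode (n : ℕ) : List ℕ := 1 :: (innerCode n ++ [1])

lemma mem_innerCode_le_one {n b : ℕ} (h : b ∈ innerCode n) : b ≤ 1 := by
  cases n with
  | zero => simp [innerCode] at h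
  | succ n =>
    simp only [innerCode, substitution, List.mem_append, List.mem_flatMap, List.mem_cons,
      List.mem_replicate, List.not_mem_nil, or_false] at h
    grind

lemma nextLength_wingers (w : List ℕ) :
    nextLength (2 :: (w.map (· + 3) ++ [2])) =
      ((w.map (· + 3)).map (fun k => k - 1)).sum + 2 + 1 := by
  simp [nextLength]
  omega

lemma map_upDegree_row (w : List ℕ) :
    (List.range (nextLength (2 :: (w.map (· + 3) ++ [2])))).map
        (upDegree (2 :: (w.map (· + 3) ++ [2]))) =
      (1 :: (w.flatMap substitution ++ [0] ++ [1])).map upDegreeOfCode := by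
  rw [nextLength_wingers, List.range_succ_eq_map, List.map_cons, List.map_cons, List.append_assoc,
    List.cons_append, List.nil_append, ← map_upDegree_inner w, List.map_map]
  congr 1
  · simp [upDegree_cons, upDegreeOfCode]
  apply List.map_congr_left
  intro j _
  simp only [Function.comp, upDegree_cons]
  simp

lemma map_range_wingers (m : ℕ) (f : ℕ → ℕ) :
    (List.range (m + 2)).map (fun j => if j = 0 ∨ j + 1 = m + 2 then 2 else f j) =
      2 :: ((List.range m).map (fun j => f (j + 1)) ++ [2]) := by
  rw [List.range_succ, List.range_succ_eq_map]
  simp only [List.map_append, List.map_cons, List.map_map, List.map_nil]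
  simp only [true_or, or_true, if_true, List.cons_append]
  congr 2
  apply List.map_congr_left
  intro j hj
  have := List.mem_range.1 hj
  simp only [Function.comp]
  rw [if_neg (by omega)]

lemma nextRow_wingers (w : List ℕ) (hw : ∀ b ∈ w.flatMap substitution, b ≤ 1) :
    nextRow 5 (2 :: (w.map (· + 3) ++ [2])) =
      2 :: ((w.flatMap substitution ++ [0]).map (· + 3) ++ [2]) := by
  have h := map_upDegree_row w
  have hm := nextLength_wingers w
  set d := 2 :: (w.map (· + 3) ++ [2]) with hd
  obtain ⟨m, hm⟩ : ∃ m, nextLength d = m + 2 := ⟨_, hm⟩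
  rw [nextRow, hm, map_range_wingers]
  rw [hm, List.range_succ, List.range_succ_eq_map] at h
  simp only [List.map_append, List.map_cons, List.map_map, List.map_nil, List.cons_append,
    List.cons.injEq] at h
  have h2 := (List.append_inj' h.2 rfl).1
  rw [← List.map_singleton (f := upDegreeOfCode), ← List.map_append] at h2
  congr 2
  -- For q = 5, up degree 2 gives 3 down edges and up degree 1 gives 4, that is `b + 3` for a code
  -- `b ≤ 1`.
  have h3 := congrArg (List.map (fun u => if u = 2 then 3 else 4)) h2
  rw [List.map_map, List.map_map] at h3
  refine Eq.trans ?_ (h3.trans ?_)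
  · rfl
  · apply List.map_congr_left
    intro b hb
    have hb1 : b ≤ 1 := by
      rcases List.mem_append.1 hb with hb | hb
      · exact hw b hb
      · simp_all
    interval_cases b <;> rfl

lemma downDegrees_succ (n : ℕ) :
    downDegrees 5 (n + 1) = 2 :: ((innerCode n).map (· + 3) ++ [2]) := by
  induction n with
  | zero => rfl
  | succ n ih =>
    rw [downDegrees, ih, nextRow_wingers]
    · rfl
    · intro b hb
      exact mem_innerCode_le_one (n := n + 1) (List.mem_append_left _ hb)

lemma rowLength_succ (n : ℕ) : rowLength 5 (n + 1) = (rowCode n).length := by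
  simp [rowLength, downDegrees_succ, rowCode]

lemma map_upDegree_downDegrees (n : ℕ) :
    (List.range (rowLength 5 (n + 1))).map (upDegree (downDegrees 5 n)) =
      (rowCode n).map upDegreeOfCode := by
  cases n with
  | zero => rfl
  | succ n =>
    have h := map_upDegree_row (innerCode n)
    rw [← downDegrees_succ n] at h
    have hl : rowLength 5 (n + 1 + 1) = nextLength (downDegrees 5 (n + 1)) := by
      simp [rowLength, downDegrees, nextRow]
    rw [hl, h]
    rfl

lemma mem_rowCode_le_one {n b : ℕ} (h : b ∈ rowCode n) : b ≤ 1 := by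
  simp only [rowCode, List.mem_cons, List.mem_append, List.not_mem_nil, or_false] at h
  rcases h with rfl | h | rfl
  · rfl
  · exact mem_innerCode_le_one h
  · rfl

lemma ncard_ascendants (q n : ℕ) (j : Fin (rowLength q (n + 1))) :
    (ascendants q ⟨n + 1, j⟩).ncard = upDegree (downDegrees q n) j := by
  have hinj : Set.InjOn (fun u : Vertex q => (u.2 : ℕ)) (ascendants q ⟨n + 1, j⟩) := by
    rintro ⟨a, i⟩ ⟨-, ha⟩ ⟨b, k⟩ ⟨-, hb⟩ h
    obtain rfl : a = n := by simpa using ha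
    obtain rfl : b = a := by simpa using hb
    exact congrArg _ (Fin.ext h)
  rw [← hinj.ncard_image, upDegree, ← Set.ncard_coe_finset]
  congr 1
  ext i
  simp only [ascendants, graph, SimpleGraph.fromRel_adj, Set.mem_image, Set.mem_ofPred_eq,
    Finset.coe_filter, Finset.mem_range]
  constructor
  · rintro ⟨⟨a, k⟩, ⟨⟨-, h⟩, ha⟩, rfl⟩
    obtain rfl : a = n := by simpa using ha
    rcases h with h | h
    -- `fromRel` symmetrizes the relation; the reversed orientation contradicts the row numbers.
    · exact ⟨k.2, h.2⟩
    · simp at h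
      omega
  · rintro ⟨hi, h⟩
    refine ⟨⟨n, ⟨i, hi⟩⟩, ⟨⟨?_, Or.inl ⟨rfl, h⟩⟩, rfl⟩, rfl⟩
    intro heq
    have := congrArg Sigma.fst heq
    simp at this

lemma digit_vertexType (n : ℕ) (j : Fin (rowLength 5 (n + 1))) :
    (vertexType 5 ⟨n + 1, j⟩).digit =
      (rowCode n)[(j : ℕ)]'(by rw [← rowLength_succ]; exact j.2) := by
  have hj : (j : ℕ) < (rowCode n).length := by rw [← rowLength_succ]; exact j.2
  have h : upDegree (downDegrees 5 n) j = upDegreeOfCode (rowCode n)[(j : ℕ)] := by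
    have := List.getElem_of_eq (map_upDegree_downDegrees n) (i := j) (by simp)
    simpa using this
  have hb := mem_rowCode_le_one (List.getElem_mem hj)
  rw [vertexType, ncard_ascendants, h]
  generalize (rowCode n)[(j : ℕ)] = b at hb
  interval_cases b <;> rfl

/-! ### Values of binary expansions -/

/-- The integer with the binary expansion `l`, the most significant digit coming first. -/
def binaryValue : List ℕ → ℕ
  | [] => 0
  | b :: l => b * 2 ^ l.length + binaryValue l

lemma binaryValue_append (l m : List ℕ) :
    binaryValue (l ++ m) = binaryValue l * 2 ^ m.length + binaryValue m := by
  induction l with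
  | nil => simp [binaryValue]
  | cons b l ih =>
    simp only [List.cons_append, binaryValue, ih, List.length_append, pow_add]
    ring

lemma sum_fin_eq_binaryValue (l : List ℕ) :
    ∑ i : Fin l.length, l[(i : ℕ)] * 2 ^ (l.length - 1 - (i : ℕ)) = binaryValue l := by
  induction l with
  | nil => rfl
  | cons b l ih =>
    rw [binaryValue, ← ih]
    simp only [List.length_cons]
    rw [Fin.sum_univ_succ]
    congr 1
    apply Finset.sum_congr rfl
    intro i _
    simp only [Fin.val_succ, List.getElem_cons_succ]
    congr 2
    omega

lemma phi_succ (n : ℕ) : phi (n + 1) = binaryValue (rowCode n) := by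
  rw [← sum_fin_eq_binaryValue, phi]
  refine Fintype.sum_equiv (finCongr (rowLength_succ n)) _ _ fun i => ?_
  rw [digit_vertexType]
  exact congrArg (fun k => _ * 2 ^ (k - 1 - (i : ℕ))) (rowLength_succ n)

/-! ### Words growing by substitution -/

/-- The `n`-th iterate of the substitution, applied to the word `l`. -/
def iterateSubstitution (l : List ℕ) : ℕ → List ℕ
  | 0 => l
  | n + 1 => (iterateSubstitution l n).flatMap substitution

/-- The `n`-th iterate of the substitution, applied to the letter `A`. -/
def wordA : ℕ → List ℕ := iterateSubstitution [0]

/-- The `n`-th iterate of the substitution, applied to the letter `B`. -/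
def wordB : ℕ → List ℕ := iterateSubstitution [1]

lemma wordA_succ_eq_flatMap (n : ℕ) : wordA (n + 1) = (wordA n).flatMap substitution := rfl

lemma wordB_succ_eq_flatMap (n : ℕ) : wordB (n + 1) = (wordB n).flatMap substitution := rfl

lemma wordA_succ (n : ℕ) : wordA (n + 1) = wordA n ++ wordB n := by
  induction n with
  | zero => rfl
  | succ n ih =>
    rw [wordA_succ_eq_flatMap, ih, List.flatMap_append, ← wordA_succ_eq_flatMap,
      ← wordB_succ_eq_flatMap, ih]

lemma wordB_succ (n : ℕ) : wordB (n + 1) = wordA (n + 1) ++ wordB n := by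
  induction n with
  | zero => rfl
  | succ n ih =>
    rw [wordB_succ_eq_flatMap (n + 1), ih, List.flatMap_append, ← wordA_succ_eq_flatMap,
      ← wordB_succ_eq_flatMap, ih]

/-- By induction, the substitution sends the leading A_n to A_{n+1}, and the appended 0 completes
the next inner code. -/
lemma innerCode_succ (n : ℕ) : innerCode (n + 1) = wordA n ++ innerCode n := by
  induction n with
  | zero => rfl
  | succ n ih =>
    rw [innerCode, ih, List.flatMap_append, ← wordA_succ_eq_flatMap, List.append_assoc]
    exact congrArg _ ih

/-- The value of the word `1l`, minus one. -/
def leadValue (l : List ℕ) : ℤ := 2 ^ l.length + binaryValue l - 1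

/-- Subtracting one makes the leading 1 of `m` cancel, so no constant term remains. -/
lemma leadValue_append (l m : List ℕ) :
    leadValue (l ++ m) = 2 ^ m.length * leadValue l + leadValue m := by
  simp only [leadValue, binaryValue_append, List.length_append, pow_add]
  push_cast
  ring

lemma Phi_succ (n : ℕ) :
    Phi (n + 1) = 2 ^ ((innerCode n).length + 1) * leadValue (wordA n) := by
  rw [Phi, phi_succ, phi_succ, rowCode, rowCode, innerCode_succ, List.append_assoc]
  simp only [binaryValue, binaryValue_append, leadValue, List.length_append, List.length_cons,
    List.length_nil, pow_add]
  push_cast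
  ring

lemma S_succ (n : ℕ) : S (n + 1) = 2 ^ (wordA n).length := by
  rw [S, rowLength_succ, rowLength_succ, rowCode, rowCode, innerCode_succ, ← zpow_natCast]
  congr 1
  simp only [List.length_append, List.length_cons, List.length_nil]
  push_cast
  ring

lemma leadValue_wordA_recurrence (n : ℕ) :
    leadValue (wordA (n + 2)) =
      (2 ^ (wordB (n + 1)).length + 2 ^ (wordB n).length + 1) * leadValue (wordA (n + 1)) -
        2 ^ (wordB n).length * leadValue (wordA n) := by
  have h : leadValue (wordA (n + 1)) =
      2 ^ (wordB n).length * leadValue (wordA n) + leadValue (wordB n) := by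
    rw [wordA_succ, leadValue_append]
  rw [wordA_succ (n + 1), leadValue_append, wordB_succ, leadValue_append]
  -- `h` eliminates `leadValue (wordB n)`.
  linear_combination -h

end HypPascal

theorem theorem4 (n : ℕ) (hn : 3 ≤ n) :
    (HypPascal.Phi n : ℚ) =
      (HypPascal.S n / HypPascal.S (n - 1) + HypPascal.S n + HypPascal.S (n - 1)) *
          (HypPascal.Phi (n - 1) : ℚ) -
        HypPascal.S (n - 1) ^ 2 * (HypPascal.Phi (n - 2) : ℚ) := by
  obtain ⟨m, rfl⟩ : ∃ m, n = m + 3 := ⟨n - 3, by omega⟩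
  rw [show m + 3 - 1 = m + 1 + 1 by omega, show m + 3 - 2 = m + 1 by omega,
    show m + 3 = m + 2 + 1 by omega]
  simp only [HypPascal.Phi_succ, HypPascal.S_succ, HypPascal.leadValue_wordA_recurrence]
  -- These length identities express every exponent through the lengths of A_m, B_m and the inner
  -- code, e.g. S_n / S_{n-1} = 2^|B_{m+1}|.
  have hA1 := congrArg List.length (HypPascal.wordA_succ m)
  have hA2 := congrArg List.length (HypPascal.wordA_succ (m + 1))
  have hB := congrArg List.length (HypPascal.wordB_succ m)
  have hI1 := congrArg List.length (HypPascal.innerCode_succ m)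
  have hI2 := congrArg List.length (HypPascal.innerCode_succ (m + 1))
  simp only [List.length_append] at hA1 hA2 hB hI1 hI2
  rw [show m + 2 = m + 1 + 1 from rfl, hI2, hI1, hA2, hB, hA1]
  push_cast
  simp only [pow_add]
  field_simp
  ring
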